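/- All graphs are finite and simple. For a connected graph $H$, let $\mu(H)$ denote its distance spectral radius, that is, the largest eigenvalue of the distance matrix $(d_H(u,v))_{u,v\in V(H)}$. A $[1,b]$-odd factor of a graph $H$ is a spanning subgraph $F$ of $H$ such that $d_F(v)$ is odd and $1\le d_F(v)\le b$ for every $v\in V(H)$. A graph $G$ is $k$-critical with respect to $[1,b]$-odd factor if $G-X$ has a $[1,b]$-odd factor for every $X\subseteq V(G)$ with $|X|=k$. Write $H_1\cup H_2$ for the disjoint union of $H_1$ and $H_2$, and $H_1\vee H_2$ for their join (the disjoint union together with all edges between $V(H_1)$ and $V(H_2)$). A graph is $m$-connected if it has more than $m$ vertices and remains connected whenever fewer than $m$ vertices are deleted. **Theorem 1.1.** Let $b$, $k$ and $n$ be positive integers with $b$ odd, $n\equiv k \pmod 2$ and $$n\ \ge\ \frac{b^2+2bk+5b+2k+4}{b},$$ and put $G_*=K_{k+1}\vee\bigl(K_{n-k-b-2}\cup(b+1)K_1\bigr)$. Let $G$ be a $(k+1)$-connected graph of order $n$ with $\mu(G)\le\mu(G_*)$. Then $G$ is $k$-critical with respect to $[1,b]$-odd factor, unless $G$ is isomorphic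 to $G_*$, in which case $G$ is not $k$-critical with respect to $[1,b]$-odd factor. -/

import Mathlib

namespace SimpleGraph

/-- The distance matrix `D(G) = (d(u, v))` of a graph, where `d` is the shortest-path distance.
It is only meant for connected graphs (`SimpleGraph.dist` is `0` between different components). -/
noncomputable def distanceMatrix {V : Type*} (G : SimpleGraph V) : Matrix V V ℝ :=
  Matrix.of fun u v => (G.dist u v : ℝ)

/-- The distance spectral radius `μ(G)`: the largest eigenvalue of the distance matrix. -/
noncomputable def distanceSpectralRadius {V : Type*} [Fintype V] (G : SimpleGraph V) : ℝ :=
  sSup {x : ℝ | Module.End.HasEigenvalue G.distanceMatrix.mulVecLin x}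

/-- For a nonempty finite vertex set the supremum in the definition of `μ(G)` is a maximum:
`μ(G)` is an eigenvalue of the distance matrix, and every eigenvalue is at most `μ(G)`. -/
theorem isGreatest_distanceSpectralRadius {V : Type*} [Fintype V] [Nonempty V]
    (G : SimpleGraph V) :
    IsGreatest {x : ℝ | Module.End.HasEigenvalue G.distanceMatrix.mulVecLin x}
      G.distanceSpectralRadius := by
  classical
  have hH : G.distanceMatrix.IsHermitian := by
    ext u v
    simp [distanceMatrix, Matrix.conjTranspose_apply, G.dist_comm]
  have hfin : {x : ℝ | Module.End.HasEigenvalue G.distanceMatrix.mulVecLin x}.Finite :=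
    Module.End.finite_hasEigenvalue _
  have hne : {x : ℝ | Module.End.HasEigenvalue G.distanceMatrix.mulVecLin x}.Nonempty := by
    obtain ⟨v⟩ := ‹Nonempty V›
    refine ⟨hH.eigenvalues v, ?_⟩
    refine Module.End.hasEigenvalue_of_hasEigenvector
      (x := (hH.eigenvectorBasis v : V → ℝ)) ⟨?_, ?_⟩
    · rw [Module.End.mem_eigenspace_iff]
      exact hH.mulVec_eigenvectorBasis v
    · intro h
      refine hH.eigenvectorBasis.orthonormal.ne_zero v ?_
      ext i
      exact congrFun h i
  exact ⟨hne.csSup_mem hfin, fun x hx => le_csSup hfin.bddAbove hx⟩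

/-- The join `G ∨ H`: the disjoint union of `G` and `H` together with all edges between the two
vertex sets. -/
def joinGraph {V W : Type*} (G : SimpleGraph V) (H : SimpleGraph W) : SimpleGraph (V ⊕ W) :=
  (G ⊕g H) ⊔ completeBipartiteGraph V W

/-- A finite graph is `m`-connected if it has more than `m` vertices and stays connected
whenever fewer than `m` vertices are deleted. -/
def IsVertexConnected {V : Type*} [Fintype V] (G : SimpleGraph V) (m : ℕ) : Prop :=
  m < Fintype.card V ∧
    ∀ S : Finset V, S.card < m → (G.induce {v : V | v ∉ S}).Connected

/-- `F` is a `[1, b]`-odd factor of `G`: a spanning subgraph of `G` (a graph on the same vertex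
set, all of whose edges are edges of `G`) in which every degree is odd and lies between `1` and
`b`. -/
def IsOddFactor {V : Type*} (G : SimpleGraph V) (b : ℕ) (F : SimpleGraph V) : Prop :=
  F ≤ G ∧ ∀ v : V, Odd (F.neighborSet v).ncard ∧
    1 ≤ (F.neighborSet v).ncard ∧ (F.neighborSet v).ncard ≤ b

/-- `G` is `k`-critical with respect to `[1, b]`-odd factor: `G - X` has a `[1, b]`-odd factor for
every set `X` of exactly `k` vertices. -/
def IsCriticalForOddFactor {V : Type*} (G : SimpleGraph V) (k b : ℕ) : Prop :=
  ∀ X : Finset V, X.card = k →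
    ∃ F : SimpleGraph {v : V | v ∉ X}, (G.induce {v : V | v ∉ X}).IsOddFactor b F

/-- The graph `K_{k+1} ∨ (K_{n-k-b-2} ∪ (b+1) K_1)`; it has order `n` when `n ≥ k + b + 2`. -/
def extremalGraph (n k b : ℕ) :
    SimpleGraph (Fin (k + 1) ⊕ (Fin (n - k - b - 2) ⊕ Fin (b + 1))) :=
  joinGraph (completeGraph (Fin (k + 1)))
    (completeGraph (Fin (n - k - b - 2)) ⊕g emptyGraph (Fin (b + 1)))

end SimpleGraph

/-! Combinatorial half. Replacing each vertex by a clique of odd order `b` turns `[1,b]`-odd factors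
into perfect matchings, so Tutte's theorem supplies Amahashi's obstruction: without a factor, some
`S` leaves more than `b|S|` odd components. If `G - X` has no factor, parity improves this to `b s +
2` components with `s = |S|`, and connectivity forces `s ≥ 1`. So deleting `T = X ∪ S`, of size `N =
k + s`, leaves at least `b s + 2` pairwise non-adjacent parts.

Spectral half. Choose representatives `R` of `p = b s + 1` parts, and let `m` be the number of
vertices outside `T ∪ R`. Up to scaling, the vector `(Δ, x(x+m), x(x+1))` on `T`, `R` and the rest
satisfies the eigenvector equations of `K_N ∨ (K_m ∪ p K_1)` for the eigenvalue `x - 1`, except that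
every row has the same error `-f`, where `f = quotientPoly N m p x`. Used as a test vector on `G`
itself, it bounds the distance form below by `(x - 1)‖z‖²` plus two terms that are non-negative when
`f ≤ 0`: `-f · ∑ z` and a correction for vertices sharing a part with a representative
(`sum_sum_lowerEntry`).

Comparison. Take a root `x ≥ n + b + 1` of the cubic of `G_*`; a positive eigenvector gives `μ(G_*)
≤ x - 1`, hence `μ(G) ≤ x - 1`. For `s ≥ 2` the cubic belonging to `s` is negative at `x`
(`quotientPoly_neg`), which contradicts the Rayleigh bound. For `s = 1` it is the cubic of `G_*` and
vanishes, so every inequality is tight and all adjacencies of `G` are determined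
(`eq_of_distanceSpectralRadius_le`). -/

namespace SimpleGraph

/-! ### Clique blow-ups and Amahashi's condition from Tutte's theorem -/

/-- The blow-up of `G` in which every vertex is replaced by a clique on `ι` and every edge by a
complete bipartite graph. -/
def cliqueBlowup {V : Type*} (G : SimpleGraph V) (ι : Type*) : SimpleGraph (V × ι) where
  Adj x y := x ≠ y ∧ (x.1 = y.1 ∨ G.Adj x.1 y.1)
  symm := ⟨fun _ _ h => ⟨h.1.symm, h.2.imp Eq.symm Adj.symm⟩⟩
  loopless := ⟨fun _ h => h.1 rfl⟩

section Blowup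

variable {V ι : Type*} (G : SimpleGraph V)

/-- The vertices of `G` all of whose copies in the blow-up lie in `S'`. -/
def fullFibres (S' : Set (V × ι)) : Set V := {v | ∀ i, (v, i) ∈ S'}

/-- The projection from the blow-up with `S'` removed to `G` with the full fibres removed. -/
def fibreProj (S' : Set (V × ι))
    (x : ((⊤ : (G.cliqueBlowup ι).Subgraph).deleteVerts S').verts) :
    ((fullFibres S')ᶜ : Set V) :=
  ⟨x.1.1, fun h => x.2.2 (h x.1.2)⟩

theorem fibreProj_surjective (S' : Set (V × ι)) : Function.Surjective (G.fibreProj S') := by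
  rintro ⟨v, hv⟩
  simp only [fullFibres, Set.mem_compl_iff, Set.mem_ofPred_eq, not_forall] at hv
  obtain ⟨i, hi⟩ := hv
  exact ⟨⟨(v, i), by simp [hi]⟩, rfl⟩

theorem adj_deleteVerts_of_fibreProj (S' : Set (V × ι))
    (x y : ((⊤ : (G.cliqueBlowup ι).Subgraph).deleteVerts S').verts) (hne : x ≠ y)
    (h : G.fibreProj S' x = G.fibreProj S' y ∨
      (G.induce (fullFibres S')ᶜ).Adj (G.fibreProj S' x) (G.fibreProj S' y)) :
    ((⊤ : (G.cliqueBlowup ι).Subgraph).deleteVerts S').coe.Adj x y := by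
  have hx := x.2.2
  have hy := y.2.2
  have hne' : x.1 ≠ y.1 := fun h => hne (Subtype.ext h)
  simp only [Subgraph.coe_adj, Subgraph.deleteVerts_adj, Subgraph.verts_top, Set.mem_univ,
    true_and, Subgraph.top_adj]
  refine ⟨hx, hy, hne', h.imp (fun h => congrArg Subtype.val h) (fun h => ?_)⟩
  exact h

/-- Surviving copies of one vertex are mutually adjacent, and copies of adjacent vertices are
adjacent, so walks lift and project. Components on the two sides therefore correspond. -/
theorem reachable_fibreProj_iff (S' : Set (V × ι))
    (x y : ((⊤ : (G.cliqueBlowup ι).Subgraph).deleteVerts S').verts) :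
    (G.induce (fullFibres S')ᶜ).Reachable (G.fibreProj S' x) (G.fibreProj S' y) ↔
      ((⊤ : (G.cliqueBlowup ι).Subgraph).deleteVerts S').coe.Reachable x y := by
  constructor
  · rintro ⟨p⟩
    generalize hu : G.fibreProj S' x = u at p
    generalize hv : G.fibreProj S' y = v at p
    induction p generalizing x with
    | nil =>
      by_cases hxy : x = y
      · rw [hxy]
      · exact (G.adj_deleteVerts_of_fibreProj S' x y hxy (.inl (hu.trans hv.symm))).reachable
    | cons h p ih =>
      rename_i u w v'
      obtain ⟨z, rfl⟩ := G.fibreProj_surjective S' w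
      subst hu
      have hxz : x ≠ z := fun hxz => h.ne (by rw [hxz])
      exact (G.adj_deleteVerts_of_fibreProj S' x z hxz (.inr h)).reachable.trans (ih z rfl hv)
  · rintro ⟨p⟩
    induction p with
    | nil => rfl
    | cons h p ih =>
      refine Reachable.trans ?_ ih
      rename_i u w v'
      simp only [Subgraph.coe_adj, Subgraph.deleteVerts_adj, Subgraph.verts_top, Set.mem_univ,
        true_and, Subgraph.top_adj] at h
      rcases h.2.2.2 with h | h
      · have : G.fibreProj S' u = G.fibreProj S' w := Subtype.ext h
        rw [this]
      · exact Adj.reachable (by simpa [fibreProj] using h)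

/-- A vertex set violating Tutte's condition in a blow-up yields a vertex set of the base graph
whose removal leaves many odd components. -/
theorem card_oddComponents_cliqueBlowup_le [Finite V] {b : ℕ} (S' : Set (V × Fin b)) :
    ((⊤ : (G.cliqueBlowup (Fin b)).Subgraph).deleteVerts S').coe.oddComponents.ncard +
        b * (fullFibres S').ncard ≤
      (G.induce (fullFibres S')ᶜ).oddComponents.ncard + S'.ncard := by
  classical
  set K' := ((⊤ : (G.cliqueBlowup (Fin b)).Subgraph).deleteVerts S').coe with hK'
  set K := G.induce (fullFibres S')ᶜ with hK
  set full : Set (V × Fin b) := fullFibres S' ×ˢ Set.univ with hfull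
  have hfullsub : full ⊆ S' := by
    rintro ⟨v, i⟩ ⟨hv, -⟩
    exact hv i
  have hfullcard : full.ncard = b * (fullFibres S').ncard := by
    rw [hfull, Set.ncard_prod, Set.ncard_univ, Nat.card_eq_fintype_card, Fintype.card_fin, mul_comm]
  have hS' : S'.ncard = full.ncard + (S' \ full).ncard := by
    rw [add_comm, Set.ncard_sdiff_add_ncard_of_subset hfullsub]
  let Φ : K'.ConnectedComponent → K.ConnectedComponent :=
    ConnectedComponent.lift (fun x => K.connectedComponentMk (G.fibreProj S' x)) (by
      intro x y p _
      exact ConnectedComponent.sound ((G.reachable_fibreProj_iff S' x y).2 ⟨p⟩))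
  have hΦ : Function.Injective Φ := by
    intro C D
    induction C using ConnectedComponent.ind
    induction D using ConnectedComponent.ind
    intro h
    exact ConnectedComponent.sound ((G.reachable_fibreProj_iff S' _ _).1 (ConnectedComponent.exact h))
  -- If `S'` misses every fibre over `Φ C`, then `C` is all of those fibres and `|C| = b |Φ C|`, so
  -- an odd `C` has an odd image. Each odd component with a non-odd image can thus be charged to a
  -- vertex of `S'` in a partially deleted fibre, and distinct components are charged to distinct
  -- vertices.
  have key : ∀ C : K'.ConnectedComponent, C ∈ K'.oddComponents → Φ C ∉ K.oddComponents →
      ∃ x ∈ S' \ full, ∃ h : x.1 ∈ (fullFibres S')ᶜ,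
        K.connectedComponentMk ⟨x.1, h⟩ = Φ C := by
    intro C hC hΦC
    by_contra! hno
    apply hΦC
    have hcard : C.supp.ncard = (Φ C).supp.ncard * b := by
      have h1 : (Φ C).supp.ncard * b = ((Φ C).supp ×ˢ (Set.univ : Set (Fin b))).ncard := by
        rw [Set.ncard_prod, Set.ncard_univ, Nat.card_eq_fintype_card, Fintype.card_fin]
      rw [h1]
      refine Set.ncard_congr (fun x _ => (G.fibreProj S' x, x.1.2)) ?_ ?_ ?_
      · intro x hx
        refine ⟨?_, trivial⟩
        rw [ConnectedComponent.mem_supp_iff] at hx ⊢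
        rw [← hx]
        rfl
      · intro x y _ _ hxy
        rw [Prod.mk.injEq] at hxy
        exact Subtype.ext (Prod.ext (congrArg Subtype.val hxy.1) hxy.2)
      · rintro ⟨⟨v, hv⟩, i⟩ ⟨hvC, -⟩
        have hvC' : K.connectedComponentMk ⟨v, hv⟩ = Φ C := hvC
        have hi : (v, i) ∉ S' := fun hi => hno (v, i) ⟨hi, fun h => hv h.1⟩ hv hvC'
        refine ⟨⟨(v, i), by simp [hi]⟩, ?_, rfl⟩
        rw [ConnectedComponent.mem_supp_iff]
        exact hΦ hvC'
    have hodd : Odd C.supp.ncard := hC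
    rw [hcard, Nat.odd_mul] at hodd
    exact hodd.1
  have hex : ∀ C : K'.ConnectedComponent, ∃ x : V × Fin b,
      C ∈ K'.oddComponents → Φ C ∉ K.oddComponents → x ∈ S' \ full ∧
        ∃ h : x.1 ∈ (fullFibres S')ᶜ, K.connectedComponentMk ⟨x.1, h⟩ = Φ C := by
    intro C
    by_cases h : C ∈ K'.oddComponents ∧ Φ C ∉ K.oddComponents
    · obtain ⟨x, hx, hx'⟩ := key C h.1 h.2
      exact ⟨x, fun _ _ => ⟨hx, hx'⟩⟩
    · obtain ⟨y, -⟩ := C.nonempty_supp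
      exact ⟨y.1, fun h1 h2 => absurd ⟨h1, h2⟩ h⟩
  choose g hg using hex
  have h1 : (K'.oddComponents ∩ Φ ⁻¹' K.oddComponents).ncard ≤ K.oddComponents.ncard :=
    Set.ncard_le_ncard_of_injOn Φ (fun C hC => hC.2) hΦ.injOn
  have h2 : (K'.oddComponents \ Φ ⁻¹' K.oddComponents).ncard ≤ (S' \ full).ncard := by
    refine Set.ncard_le_ncard_of_injOn g (fun C hC => (hg C hC.1 hC.2).1) ?_
    intro C hC D hD hCD
    apply hΦ
    obtain ⟨h, hC'⟩ := (hg C hC.1 hC.2).2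
    obtain ⟨h', hD'⟩ := (hg D hD.1 hD.2).2
    rw [← hC', ← hD']
    congr 2
    rw [hCD]
  have h3 := Set.ncard_inter_add_ncard_sdiff_eq_ncard K'.oddComponents (Φ ⁻¹' K.oddComponents)
  omega

end Blowup

/-- A perfect matching of the blow-up of `G` by cliques of odd order `b` yields a
`[1, b]`-odd factor of `G`: keep the edges that are used an odd number of times. -/
theorem exists_isOddFactor_of_isPerfectMatching {V : Type*} [Finite V] (G : SimpleGraph V) {b : ℕ}
    (hb : Odd b) {M : (G.cliqueBlowup (Fin b)).Subgraph} (hM : M.IsPerfectMatching) :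
    ∃ F, G.IsOddFactor b F := by
  classical
  cases nonempty_fintype V
  rw [Subgraph.isPerfectMatching_iff] at hM
  choose f hf hf' using hM
  have hff : ∀ x, f (f x) = x := fun x => ((hf' (f x)) x (hf x).symm).symm
  have hfne : ∀ x, f x ≠ x := fun x h => by
    have := (hf x).adj_sub
    rw [h] at this
    exact this.ne rfl
  let m : V → V → ℕ := fun u v => (Finset.univ.filter fun i : Fin b => (f (u, i)).1 = v).card
  have hmsymm : ∀ u v, m u v = m v u := by
    intro u v
    refine Finset.card_bij' (fun i _ => (f (u, i)).2) (fun i _ => (f (v, i)).2) ?_ ?_ ?_ ?_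
    · intro i hi
      simp only [Finset.mem_filter, Finset.mem_univ, true_and] at hi ⊢
      rw [← hi, Prod.mk.eta, hff]
    · intro i hi
      simp only [Finset.mem_filter, Finset.mem_univ, true_and] at hi ⊢
      rw [← hi, Prod.mk.eta, hff]
    · intro i hi
      simp only [Finset.mem_filter, Finset.mem_univ, true_and] at hi
      rw [← hi, Prod.mk.eta, hff]
    · intro i hi
      simp only [Finset.mem_filter, Finset.mem_univ, true_and] at hi
      rw [← hi, Prod.mk.eta, hff]
  have hsum : ∀ u, ∑ v, m u v = b := by
    intro u
    have := Finset.card_eq_sum_card_fiberwise (f := fun i : Fin b => (f (u, i)).1)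
      (s := Finset.univ) (t := Finset.univ) (by simp)
    simpa using this.symm
  -- The matching acts as a fixed-point-free involution on the copies of `u` matched inside their
  -- own fibre; the count is evaluated in `ZMod 2`.
  have heven : ∀ u, Even (m u u) := by
    intro u
    simp only [m]
    rw [← ZMod.natCast_eq_zero_iff_even, Finset.card_eq_sum_ones, Nat.cast_sum]
    have hmem : ∀ i ∈ Finset.univ.filter fun i : Fin b => (f (u, i)).1 = u,
        f (u, i) = (u, (f (u, i)).2) := by
      intro i hi
      simp only [Finset.mem_filter, Finset.mem_univ, true_and] at hi
      exact Prod.ext hi rfl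
    refine Finset.sum_involution (fun i _ => (f (u, i)).2) ?_ ?_ ?_ ?_
    · intro i _
      decide
    · intro i hi _ h
      have := hmem i hi
      rw [h] at this
      exact hfne _ this
    · intro i hi
      simp only [Finset.mem_filter, Finset.mem_univ, true_and]
      rw [← hmem i hi, hff]
    · intro i hi
      rw [← hmem i hi, hff]
  let F : SimpleGraph V :=
    { Adj := fun u v => u ≠ v ∧ Odd (m u v)
      symm := ⟨fun u v h => ⟨h.1.symm, hmsymm u v ▸ h.2⟩⟩
      loopless := ⟨fun _ h => h.1 rfl⟩ }
  have hFle : F ≤ G := by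
    intro u v h
    obtain ⟨i, hi⟩ := Finset.card_pos.1 h.2.pos
    simp only [Finset.mem_filter, Finset.mem_univ, true_and] at hi
    have := (hf (u, i)).adj_sub.2
    rw [hi] at this
    exact this.resolve_left h.1
  have hdeg : ∀ u, (F.neighborSet u).ncard = (Finset.univ.filter fun v => Odd (m u v)).card := by
    intro u
    rw [← Set.ncard_coe_finset]
    congr 1
    ext v
    simp only [mem_neighborSet, Finset.coe_filter, Finset.mem_univ, true_and, Set.mem_ofPred_eq]
    refine ⟨fun h => h.2, fun h => ⟨?_, h⟩⟩
    rintro rfl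
    exact (Nat.not_odd_iff_even.2 (heven u)) h
  refine ⟨F, hFle, fun u => ?_⟩
  -- The multiplicities at `u` sum to the odd number `b`, so an odd number of them are odd.
  have hodd : Odd (F.neighborSet u).ncard := by
    rw [hdeg, ← Finset.odd_sum_iff_odd_card_odd, hsum]
    exact hb
  refine ⟨hodd, hodd.pos, ?_⟩
  rw [hdeg, ← hsum u, Finset.card_eq_sum_ones, Finset.sum_filter]
  refine Finset.sum_le_sum fun v _ => ?_
  split_ifs with h
  · exact h.pos
  · exact Nat.zero_le _

/-- Sufficiency in Amahashi's theorem on `[1, b]`-odd factors. -/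
theorem exists_oddComponents_of_not_isOddFactor {V : Type*} [Finite V] (G : SimpleGraph V) {b : ℕ}
    (hb : Odd b) (h : ¬ ∃ F, G.IsOddFactor b F) :
    ∃ S : Set V, b * S.ncard < (G.induce Sᶜ).oddComponents.ncard := by
  have hno : ¬ ∃ M : (G.cliqueBlowup (Fin b)).Subgraph, M.IsPerfectMatching :=
    fun ⟨_, hM⟩ => h (G.exists_isOddFactor_of_isPerfectMatching hb hM)
  rw [tutte] at hno
  push Not at hno
  obtain ⟨S', hS'⟩ := hno
  refine ⟨fullFibres S', ?_⟩
  have := G.card_oddComponents_cliqueBlowup_le S'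
  unfold IsTutteViolator at hS'
  omega

end SimpleGraph

/-! ### Separating sets and representatives of the remaining parts -/

namespace SimpleGraph

universe u

/-- A highly connected graph that is not `k`-critical has a vertex set `T` of size `k + s` whose
removal leaves at least `b * s + 2` components; these are recorded as the values of a colouring
`c` that separates non-adjacent vertices. -/
theorem exists_coloring_of_not_isCriticalForOddFactor {V : Type u} [Fintype V] (G : SimpleGraph V)
    {b k : ℕ} (hb : Odd b) (hpar : Fintype.card V ≡ k [MOD 2])
    (hconn : G.IsVertexConnected (k + 1)) (h : ¬ G.IsCriticalForOddFactor k b) :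
    ∃ (s : ℕ) (T : Finset V) (ι : Type u) (c : V → ι) (C : Finset ι), 1 ≤ s ∧ T.card = k + s ∧
      (∀ u v, u ∉ T → v ∉ T → c u ≠ c v → ¬ G.Adj u v) ∧ b * s + 2 ≤ C.card ∧
      ∀ i ∈ C, ∃ v, v ∉ T ∧ c v = i := by
  classical
  simp only [IsCriticalForOddFactor, not_forall] at h
  obtain ⟨X, hX, hF⟩ := h
  obtain ⟨S, hS⟩ := exists_oddComponents_of_not_isOddFactor _ hb hF
  set H := G.induce {v : V | v ∉ X} with hH
  set K := H.induce Sᶜ with hK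
  have hHconn : H.Connected := hconn.2 X (by omega)
  have hcardH : Nat.card {v : V | v ∉ X} + k = Fintype.card V := by
    have : {v : V | v ∉ X} = ((Xᶜ : Finset V) : Set V) := by ext; simp
    rw [this, Nat.card_coe_set_eq, Set.ncard_coe_finset, Finset.card_compl, hX]
    have := X.card_le_univ
    omega
  have hcardK : Nat.card (Sᶜ : Set {v : V | v ∉ X}) + S.ncard = Nat.card {v : V | v ∉ X} := by
    rw [Nat.card_coe_set_eq, add_comm, Set.ncard_add_ncard_compl]
  have hpar' : Odd K.oddComponents.ncard ↔ Odd (Nat.card (Sᶜ : Set {v : V | v ∉ X})) :=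
    K.odd_ncard_oddComponents
  -- The number of odd components has the parity of `n - k - |S|`, which is that of `|S|` and, as
  -- `b` is odd, of `b|S|`. The strict inequality therefore improves by one.
  have hodd : b * S.ncard + 2 ≤ K.oddComponents.ncard := by
    have h1 : Odd (b * S.ncard) ↔ Odd S.ncard := by
      rw [Nat.odd_mul]; exact ⟨fun h => h.2, fun h => ⟨hb, h⟩⟩
    have h2 : K.oddComponents.ncard ≠ b * S.ncard + 1 := by
      intro heq
      rw [heq, Nat.odd_add_one, h1] at hpar'
      rw [Nat.ModEq] at hpar
      simp only [Nat.odd_iff] at hpar'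
      omega
    omega
  have hS1 : 1 ≤ S.ncard := by
    by_contra! hlt
    have hS0 : S = ∅ := by
      rw [← Set.ncard_eq_zero]
      omega
    have hKconn : K.Preconnected := by
      intro x y
      let φ : H →g K := ⟨fun v => ⟨v, by simp [hS0]⟩, fun h => h⟩
      exact (hHconn.preconnected x.1 y.1).map φ
    have hsub := hKconn.subsingleton_connectedComponent
    have := Set.ncard_le_one_of_subsingleton K.oddComponents
    omega
  have hpos : 0 < K.oddComponents.ncard := by omega
  obtain ⟨C0, -⟩ := (Set.ncard_pos (Set.toFinite _)).1 hpos
  let T : Finset V := X ∪ S.toFinset.map (Function.Embedding.subtype _)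
  have hT : ∀ v, v ∉ T ↔ ∃ h : v ∉ X, (⟨v, h⟩ : {v : V | v ∉ X}) ∈ Sᶜ := by
    intro v
    simp only [T, Finset.mem_union, Finset.mem_map, Set.mem_toFinset, not_or,
      Function.Embedding.subtype_apply, Subtype.exists, exists_and_right, exists_eq_right,
      not_exists, Set.mem_compl_iff]
    exact ⟨fun h => ⟨h.1, h.2 h.1⟩, fun ⟨h, h'⟩ => ⟨h, fun _ => h'⟩⟩
  have hTcard : T.card = k + S.ncard := by
    rw [Finset.card_union_of_disjoint, hX, Finset.card_map, Set.ncard_eq_toFinset_card']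
    rw [Finset.disjoint_left]
    intro v hv hv'
    obtain ⟨w, -, rfl⟩ := Finset.mem_map.1 hv'
    exact w.2 hv
  -- The value `C0` on `T` is a dummy: colours matter only outside `T`.
  let c : V → K.ConnectedComponent := fun v =>
    if h : ∃ h : v ∉ X, (⟨v, h⟩ : {v : V | v ∉ X}) ∈ Sᶜ then
      K.connectedComponentMk ⟨⟨v, h.1⟩, h.2⟩ else C0
  refine ⟨S.ncard, T, K.ConnectedComponent, c, (Set.toFinite K.oddComponents).toFinset, hS1,
    hTcard, ?_, ?_, ?_⟩
  · intro u v hu hv huv hadj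
    rw [hT] at hu hv
    simp only [c, dif_pos hu, dif_pos hv] at huv
    exact huv (ConnectedComponent.sound (Adj.reachable hadj))
  · rwa [← Set.ncard_eq_toFinset_card]
  · intro i _
    induction i using ConnectedComponent.ind with
    | h w =>
      have hw : ∃ h : w.1.1 ∉ X, (⟨w.1.1, h⟩ : {v : V | v ∉ X}) ∈ Sᶜ := ⟨w.1.2, w.2⟩
      exact ⟨w.1.1, (hT _).2 hw, dif_pos hw⟩

/-- Representatives of the colour classes outside `T`: a set `R` of `q` vertices with distinct
colours, avoiding one further colour `i₀`, which has at least two vertices unless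
every vertex outside `T ∪ R` avoids the colours of `R`. -/
theorem exists_representatives {V ι : Type*} [Fintype V] [DecidableEq V] [DecidableEq ι]
    (T : Finset V) (c : V → ι)
    (C : Finset ι) (q : ℕ) (hC : q + 1 ≤ C.card) (hc : ∀ i ∈ C, ∃ v, v ∉ T ∧ c v = i) :
    ∃ (R : Finset V) (i₀ : ι), Disjoint T R ∧ R.card = q ∧ Set.InjOn c R ∧ i₀ ∉ R.image c ∧
      ((T ∪ R)ᶜ.filter fun v => c v = i₀).Nonempty ∧
      (2 ≤ ((T ∪ R)ᶜ.filter fun v => c v = i₀).card ∨ ∀ v ∈ (T ∪ R)ᶜ, c v ∉ R.image c) := by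
  -- A class with two vertices is reserved as `i₀` if there is one. Otherwise every class of `C` is
  -- a single vertex, so the representatives exhaust their classes.
  obtain ⟨i₀, hi₀C, hi₀⟩ : ∃ i₀ ∈ C, 2 ≤ (Tᶜ.filter fun v => c v = i₀).card ∨
      ∀ i ∈ C, (Tᶜ.filter fun v => c v = i).card ≤ 1 := by
    by_cases h : ∃ i₀ ∈ C, 2 ≤ (Tᶜ.filter fun v => c v = i₀).card
    · obtain ⟨i, hi, hi'⟩ := h
      exact ⟨i, hi, .inl hi'⟩
    · push Not at h
      obtain ⟨i, hi⟩ := Finset.card_pos.1 (show 0 < C.card by omega)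
      exact ⟨i, hi, .inr fun i hi => by have := h i hi; omega⟩
  have : Nonempty V := let ⟨v, _⟩ := hc i₀ hi₀C; ⟨v⟩
  choose! g hgT hg using hc
  obtain ⟨D, hD, hDq⟩ := Finset.exists_subset_card_eq
    (show q ≤ (C.erase i₀).card by rw [Finset.card_erase_of_mem hi₀C]; omega)
  have hDC : ∀ i ∈ D, i ∈ C := fun i hi => Finset.mem_of_mem_erase (hD hi)
  have hRimg : (D.image g).image c = D := by
    rw [Finset.image_image]
    conv_rhs => rw [← Finset.image_id (s := D)]
    exact Finset.image_congr fun i hi => hg i (hDC i hi)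
  have hi₀D : i₀ ∉ D := fun h => Finset.ne_of_mem_erase (hD h) rfl
  have hfib : ((T ∪ D.image g)ᶜ.filter fun v => c v = i₀) = Tᶜ.filter fun v => c v = i₀ := by
    ext v
    simp only [Finset.mem_filter, Finset.mem_compl, Finset.mem_union, not_or, and_congr_left_iff,
      and_iff_left_iff_imp]
    intro hv _ hvD
    have := Finset.mem_image_of_mem c hvD
    rw [hRimg, hv] at this
    exact hi₀D this
  refine ⟨D.image g, i₀, ?_, ?_, ?_, by rwa [hRimg], ?_, ?_⟩
  · rw [Finset.disjoint_right]
    intro v hv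
    obtain ⟨i, hi, rfl⟩ := Finset.mem_image.1 hv
    exact hgT i (hDC i hi)
  · rw [Finset.card_image_of_injOn, hDq]
    intro i hi j hj hij
    rw [← hg i (hDC i hi), hij, hg j (hDC j hj)]
  · intro v hv w hw hvw
    obtain ⟨i, hi, rfl⟩ := Finset.mem_image.1 hv
    obtain ⟨j, hj, rfl⟩ := Finset.mem_image.1 hw
    rw [hg i (hDC i hi), hg j (hDC j hj)] at hvw
    rw [hvw]
  · rw [hfib]
    exact ⟨g i₀, by simp [hgT i₀ hi₀C, hg i₀ hi₀C]⟩
  · rw [hfib]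
    refine hi₀.imp id fun h v hv hvR => ?_
    rw [hRimg] at hvR
    simp only [Finset.mem_compl, Finset.mem_union, not_or] at hv
    have h1 := Finset.card_le_one.1 (h _ (hDC _ hvR)) v (by simp [hv.1]) (g (c v))
      (by simp [hgT _ (hDC _ hvR), hg _ (hDC _ hvR)])
    exact hv.2 (Finset.mem_image.2 ⟨c v, hvR, h1.symm⟩)

end SimpleGraph

/-! ### Rayleigh bounds and the distance form at a three-valued vector -/

namespace SimpleGraph

open Finset

section Rayleigh

variable {V : Type*} [Fintype V]

/-- The Rayleigh bound for the distance spectral radius. -/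
theorem sum_dist_mul_le [Nonempty V] (G : SimpleGraph V) (z : V → ℝ) :
    ∑ u, ∑ v, (G.dist u v : ℝ) * (z u * z v) ≤ G.distanceSpectralRadius * ∑ v, z v ^ 2 := by
  classical
  set μ := G.distanceSpectralRadius
  set A : Matrix V V ℝ := μ • (1 : Matrix V V ℝ) - G.distanceMatrix with hA
  have hH : A.IsHermitian := by
    ext u v
    simp [hA, distanceMatrix, Matrix.conjTranspose_apply, G.dist_comm, Matrix.one_apply, eq_comm]
  have hmul : ∀ x : V → ℝ, A.mulVec x = μ • x - G.distanceMatrix.mulVec x := fun x => by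
    rw [hA, Matrix.sub_mulVec, Matrix.smul_mulVec, Matrix.one_mulVec]
  have hpos : A.PosSemidef := by
    rw [hH.posSemidef_iff_eigenvalues_nonneg]
    intro i
    have hev : G.distanceMatrix.mulVec (hH.eigenvectorBasis i : V → ℝ) =
        (μ - hH.eigenvalues i) • (hH.eigenvectorBasis i : V → ℝ) := by
      rw [sub_smul, ← hH.mulVec_eigenvectorBasis i, hmul]
      abel
    -- An eigenvector of `μ - D` for `λ` is one of `D` for `μ - λ`, and `μ` is the largest
    -- eigenvalue of `D`.
    have hle : μ - hH.eigenvalues i ≤ μ := by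
      refine G.isGreatest_distanceSpectralRadius.2 ?_
      refine Module.End.hasEigenvalue_of_hasEigenvector
        (x := (hH.eigenvectorBasis i : V → ℝ)) ⟨?_, ?_⟩
      · rw [Module.End.mem_eigenspace_iff]
        exact hev
      · intro h
        refine hH.eigenvectorBasis.orthonormal.ne_zero i ?_
        ext j
        exact congrFun h j
    simpa using hle
  have h0 := hpos.dotProduct_mulVec_nonneg z
  have h1 : dotProduct (star z) (A.mulVec z) = μ * ∑ v, z v ^ 2 -
      ∑ u, ∑ v, (G.dist u v : ℝ) * (z u * z v) := by
    rw [hmul, dotProduct_sub]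
    congr 1
    · simp [dotProduct, mul_sum]
      exact sum_congr rfl fun v _ => by ring
    · simp only [dotProduct, Matrix.mulVec, distanceMatrix, Matrix.of_apply, mul_sum,
        Pi.star_apply, star_trivial]
      exact sum_congr rfl fun u _ => sum_congr rfl fun v _ => by ring
  rw [h1] at h0
  linarith

/-- A positive vector `z` with `D z ≤ ρ z` bounds the distance spectral radius by `ρ`. -/
theorem distanceSpectralRadius_le_of_pos [Nonempty V] (G : SimpleGraph V) (z : V → ℝ) (ρ : ℝ)
    (hz : ∀ v, 0 < z v) (h : ∀ u, ∑ v, (G.dist u v : ℝ) * z v ≤ ρ * z u) :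
    G.distanceSpectralRadius ≤ ρ := by
  obtain ⟨y, hy⟩ := G.isGreatest_distanceSpectralRadius.1.exists_hasEigenvector
  set θ := G.distanceSpectralRadius
  have hyθ : ∀ u, θ * y u = ∑ v, (G.dist u v : ℝ) * y v := fun u =>
    (congrFun hy.apply_eq_smul u).symm
  have habs : ∀ u, θ * |y u| ≤ ∑ v, (G.dist u v : ℝ) * |y v| := by
    intro u
    calc θ * |y u| ≤ |θ| * |y u| := by gcongr; exact le_abs_self θ
      _ = |∑ v, (G.dist u v : ℝ) * y v| := by rw [← abs_mul, hyθ]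
      _ ≤ ∑ v, |(G.dist u v : ℝ) * y v| := abs_sum_le_sum_abs _ _
      _ = _ := sum_congr rfl fun v _ => by rw [abs_mul, Nat.abs_cast]
  have hpos : 0 < ∑ u, z u * |y u| := by
    obtain ⟨v, hv⟩ := Function.ne_iff.1 hy.2
    exact sum_pos' (fun u _ => mul_nonneg (hz u).le (abs_nonneg _))
      ⟨v, mem_univ _, mul_pos (hz v) (abs_pos.2 hv)⟩
  -- Pairing `θ|y| ≤ D|y|` with `z` and moving the symmetric matrix `D` onto `z` compares `θ` with
  -- `ρ`.
  have hle : θ * ∑ u, z u * |y u| ≤ ρ * ∑ u, z u * |y u| := by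
    calc θ * ∑ u, z u * |y u| = ∑ u, z u * (θ * |y u|) := by
          rw [mul_sum]; exact sum_congr rfl fun u _ => by ring
      _ ≤ ∑ u, z u * ∑ v, (G.dist u v : ℝ) * |y v| :=
          sum_le_sum fun u _ => mul_le_mul_of_nonneg_left (habs u) (hz u).le
      _ = ∑ v, |y v| * ∑ u, (G.dist v u : ℝ) * z u := by
          simp only [mul_sum]
          rw [sum_comm]
          exact sum_congr rfl fun v _ => sum_congr rfl fun u _ => by rw [G.dist_comm]; ring
      _ ≤ ∑ v, |y v| * (ρ * z v) :=
          sum_le_sum fun v _ => mul_le_mul_of_nonneg_left (h v) (abs_nonneg _)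
      _ = _ := by rw [mul_sum]; exact sum_congr rfl fun u _ => by ring
  exact le_of_mul_le_mul_right hle hpos

end Rayleigh

theorem two_le_dist {V : Type*} {G : SimpleGraph V} (hG : G.Connected) {u v : V} (hne : u ≠ v)
    (h : ¬ G.Adj u v) : (2 : ℝ) ≤ G.dist u v := by
  have h0 : G.dist u v ≠ 0 := fun h0 => hne (hG.dist_eq_zero_iff.1 h0)
  have h1 : G.dist u v ≠ 1 := fun h1 => h (dist_eq_one_iff_adj.1 h1)
  exact_mod_cast (show 2 ≤ G.dist u v by omega)

theorem one_le_dist {V : Type*} {G : SimpleGraph V} (hG : G.Connected) {u v : V} (hne : u ≠ v) :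
    (1 : ℝ) ≤ G.dist u v := by
  exact_mod_cast hG.pos_dist_of_ne hne

section TestVector

variable {V ι : Type*} [Fintype V] [DecidableEq V] [DecidableEq ι]

/-- The vector equal to `a` on `T`, to `r` on `R` and to `β` elsewhere. -/
def threeValued (T R : Finset V) (a β r : ℝ) (v : V) : ℝ :=
  if v ∈ T then a else if v ∈ R then r else β

theorem sum_threeValued_apply {T R : Finset V} (hTR : Disjoint T R) (a β r : ℝ) (f : ℝ → ℝ) :
    ∑ v, f (threeValued T R a β r v) =
      #T * f a + #R * f r + #(T ∪ R)ᶜ * f β := by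
  rw [← sum_add_sum_compl (T ∪ R), sum_union hTR]
  congr 1
  · congr 1
    · rw [sum_congr rfl (g := fun _ => f a), sum_const, nsmul_eq_mul]
      intro v hv
      simp [threeValued, hv]
    · rw [sum_congr rfl (g := fun _ => f r), sum_const, nsmul_eq_mul]
      intro v hv
      simp [threeValued, hv, disjoint_right.1 hTR hv]
  · rw [sum_congr rfl (g := fun _ => f β), sum_const, nsmul_eq_mul]
    intro v hv
    simp only [mem_compl, mem_union, not_or] at hv
    simp [threeValued, hv.1, hv.2]

/-- The entry of the quadratic form that bounds the distance form from below in
`le_sum_dist_mul`. -/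
def lowerEntry (T R : Finset V) (c : V → ι) (i₀ : ι) (a β r : ℝ) (u v : V) : ℝ :=
  let z := threeValued T R a β r
  z u * z v - (if u = v then z u ^ 2 else 0) +
    (if u ∈ Tᶜ then z u else 0) * (if v ∈ Tᶜ then z v else 0) -
    (if u ∈ (T ∪ R)ᶜ then β else 0) * (if v ∈ (T ∪ R)ᶜ then β else 0) -
    (if u = v then (if u ∈ R then r ^ 2 else 0) else 0) +
    ((if u ∈ (T ∪ R)ᶜ ∧ c u = i₀ then β else 0) *
        (if v ∈ (T ∪ R)ᶜ ∧ c v ∈ R.image c then β else 0) -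
      (if v ∈ (T ∪ R)ᶜ then if u ∈ R ∧ c u = c v then r * β else 0 else 0)) +
    ((if v ∈ (T ∪ R)ᶜ ∧ c v = i₀ then β else 0) *
        (if u ∈ (T ∪ R)ᶜ ∧ c u ∈ R.image c then β else 0) -
      (if u ∈ (T ∪ R)ᶜ then if v ∈ R ∧ c v = c u then r * β else 0 else 0))

/-- Distinct vertices are at distance at least 1, and at least 2 if outside `T` with different
colours. Treating `R` as isolated outside `T` and the rest as a clique overcounts only when a vertex
of `R` shares its colour with a vertex outside `T ∪ R`; there `rβ` is subtracted. In exchange `β²`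
is added between that vertex and each vertex of colour `i₀`, a pair wrongly treated as adjacent. -/
theorem lowerEntry_le {G : SimpleGraph V} (hG : G.Connected) {T R : Finset V}
    (hTR : Disjoint T R) {c : V → ι} (hc : ∀ u v, u ∉ T → v ∉ T → c u ≠ c v → ¬ G.Adj u v)
    (hR : Set.InjOn c R) {i₀ : ι} (hi₀ : i₀ ∉ R.image c) {a β r : ℝ} (ha : 0 < a) (hβ : 0 < β)
    (hr : 0 < r) (u v : V) :
    lowerEntry T R c i₀ a β r u v ≤
      G.dist u v * (threeValued T R a β r u * threeValued T R a β r v) := by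
  have hmem : ∀ x, x ∈ R → x ∉ T := fun x hx => disjoint_right.1 hTR hx
  have hi₀' : ∀ x ∈ R, c x ≠ i₀ := fun x hx h => hi₀ (mem_image.2 ⟨x, hx, h⟩)
  have hz : ∀ x, 0 < threeValued T R a β r x := fun x => by
    unfold threeValued
    split_ifs <;> assumption
  have himg : ∀ x ∈ R, c x ∈ R.image c := fun x hx => mem_image_of_mem c hx
  rcases eq_or_ne u v with rfl | hne
  · rw [dist_self]
    by_cases hT : u ∈ T
    · have : u ∉ R := fun h => hmem u h hT
      simp [lowerEntry, threeValued, hT, this, ← sq]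
    by_cases hRu : u ∈ R
    · simp [lowerEntry, threeValued, hT, hRu, ← sq]
    · by_cases h1 : c u = i₀
      · simp [lowerEntry, threeValued, hT, hRu, ← sq, h1, hi₀]
      · simp [lowerEntry, threeValued, hT, hRu, ← sq, h1]
  have h1 := one_le_dist hG hne
  by_cases huT : u ∈ T
  · have huR : u ∉ R := fun h => hmem u h huT
    have := mul_pos (hz u) (hz v)
    simp only [lowerEntry, huT, huR, hne, mem_compl, mem_union]
    simp only [if_false, not_true, false_and, or_false]
    simp
    nlinarith
  by_cases hvT : v ∈ T
  · have hvR : v ∉ R := fun h => hmem v h hvT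
    have := mul_pos (hz u) (hz v)
    simp [lowerEntry, hvT, hvR, hne]
    nlinarith
  have h2 : c u ≠ c v → (2 : ℝ) ≤ G.dist u v := fun h => two_le_dist hG hne (hc u v huT hvT h)
  have hrβ := mul_pos hr hβ
  have hrr := mul_pos hr hr
  have hββ := mul_pos hβ hβ
  by_cases huR : u ∈ R <;> by_cases hvR : v ∈ R
  · have h2' := h2 (fun h => hne (hR huR hvR h))
    simp [lowerEntry, threeValued, huT, hvT, huR, hvR, hne]
    nlinarith
  · by_cases hcc : c u = c v
    · simp [lowerEntry, threeValued, huT, hvT, huR, hvR, hne, hcc]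
      nlinarith
    · have h2' := h2 hcc
      simp [lowerEntry, threeValued, huT, hvT, huR, hvR, hne, hcc]
      nlinarith
  · by_cases hcc : c v = c u
    · simp [lowerEntry, threeValued, huT, hvT, huR, hvR, hne, hcc]
      nlinarith
    · have h2' := h2 (Ne.symm hcc)
      simp [lowerEntry, threeValued, huT, hvT, huR, hvR, hne, hcc]
      nlinarith
  · by_cases hcc : c u = c v
    · by_cases hi : c v = i₀
      · simp [lowerEntry, threeValued, huT, hvT, huR, hvR, hne, hcc, hi, hi₀]
        nlinarith
      · simp [lowerEntry, threeValued, huT, hvT, huR, hvR, hne, hcc, hi]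
        nlinarith
    · have h2' := h2 hcc
      by_cases hu : c u = i₀ <;> by_cases hv : c v = i₀
      · exact absurd (hu.trans hv.symm) hcc
      · by_cases hvi : c v ∈ R.image c
        · simp only [lowerEntry, threeValued, huT, hvT, huR, hvR, hne, hu, hv, hvi, hi₀, mem_compl,
            mem_union]
          simp
          nlinarith
        · simp only [lowerEntry, threeValued, huT, hvT, huR, hvR, hne, hu, hv, hvi, hi₀, mem_compl,
            mem_union]
          simp
          nlinarith
      · by_cases hvi : c u ∈ R.image c
        · simp only [lowerEntry, threeValued, huT, hvT, huR, hvR, hne, hu, hv, hvi, hi₀, mem_compl,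
            mem_union]
          simp
          nlinarith
        · simp only [lowerEntry, threeValued, huT, hvT, huR, hvR, hne, hu, hv, hvi, hi₀, mem_compl,
            mem_union]
          simp
          nlinarith
      · simp [lowerEntry, threeValued, huT, hvT, huR, hvR, hne, hu, hv]
        nlinarith

/-- The entries of `lowerEntry` are strictly smaller at the non-adjacent pairs that meet `T` or
avoid `R`, provided that no vertex outside `T ∪ R` has a colour of `R`. -/
theorem lowerEntry_lt {G : SimpleGraph V} (hG : G.Connected) {T R : Finset V}
    (hTR : Disjoint T R) {c : V → ι} (i₀ : ι)
    (hW : ∀ v ∈ (T ∪ R)ᶜ, c v ∉ R.image c) {a β r : ℝ} (ha : 0 < a) (hβ : 0 < β)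
    (hr : 0 < r) {u v : V} (hne : u ≠ v) (hadj : ¬ G.Adj u v)
    (huv : u ∈ T ∨ v ∈ T ∨ (u ∉ R ∧ v ∉ R)) :
    lowerEntry T R c i₀ a β r u v <
      G.dist u v * (threeValued T R a β r u * threeValued T R a β r v) := by
  have hmem : ∀ x, x ∈ R → x ∉ T := fun x hx => disjoint_right.1 hTR hx
  have hz : ∀ x, 0 < threeValued T R a β r x := fun x => by
    unfold threeValued
    split_ifs <;> assumption
  have h2 := two_le_dist hG hne hadj
  have hzz := mul_pos (hz u) (hz v)
  by_cases huT : u ∈ T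
  · have huR : u ∉ R := fun h => hmem u h huT
    simp only [lowerEntry, huT, huR, hne, mem_compl, mem_union]
    simp
    nlinarith
  by_cases hvT : v ∈ T
  · have hvR : v ∉ R := fun h => hmem v h hvT
    simp [lowerEntry, hvT, hvR, hne]
    nlinarith
  obtain ⟨huR, hvR⟩ := (huv.resolve_left huT).resolve_left hvT
  have hu := hW u (by simp [huT, huR])
  have hv := hW v (by simp [hvT, hvR])
  simp only [lowerEntry, threeValued, huT, hvT, huR, hvR, hne, hu, hv, mem_compl, mem_union]
  simp
  nlinarith [mul_pos hβ hβ]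

theorem sum_ite_mem_const (s : Finset V) (x : ℝ) : (∑ v, if v ∈ s then x else 0) = #s * x := by
  rw [sum_ite_mem, univ_inter, sum_const, nsmul_eq_mul]

/-- By injectivity of `c` on `R`, each of the `W` vertices sharing a colour with `R` loses exactly
one `rβ` and gains `C` terms `β²`, in both orders. Hence the net correction `2Wβ(Cβ - r)`. -/
theorem sum_sum_lowerEntry {T R : Finset V} (hTR : Disjoint T R) {c : V → ι}
    (hR : Set.InjOn c R) (i₀ : ι) (a β r : ℝ) {N p m C W : ℝ} (hN : (#T : ℝ) = N)
    (hp : (#R : ℝ) = p) (hm : (#(T ∪ R)ᶜ : ℝ) = m)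
    (hC : (#((T ∪ R)ᶜ.filter fun v => c v = i₀) : ℝ) = C)
    (hW : (#((T ∪ R)ᶜ.filter fun v => c v ∈ R.image c) : ℝ) = W) :
    ∑ u, ∑ v, lowerEntry T R c i₀ a β r u v =
      (N * a + p * r + m * β) ^ 2 - (N * a ^ 2 + p * r ^ 2 + m * β ^ 2) + (p * r + m * β) ^ 2 -
        (m * β) ^ 2 - p * r ^ 2 + 2 * (W * (β * (C * β - r))) := by
  have hz1 : ∑ v, threeValued T R a β r v = N * a + p * r + m * β := by
    have := sum_threeValued_apply hTR a β r id
    simp only [id] at this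
    rw [this, hN, hp, hm]
  have hz2 : ∑ v, threeValued T R a β r v ^ 2 = N * a ^ 2 + p * r ^ 2 + m * β ^ 2 := by
    rw [sum_threeValued_apply hTR a β r (fun x => x ^ 2), hN, hp, hm]
  have hg : (∑ v, if v ∈ Tᶜ then threeValued T R a β r v else 0) = p * r + m * β := by
    have h1 : ∀ v, (if v ∈ Tᶜ then threeValued T R a β r v else 0) = threeValued T R 0 β r v := by
      intro v
      by_cases h : v ∈ T <;> simp [threeValued, h]
    have := sum_threeValued_apply hTR 0 β r id
    simp only [id] at this
    rw [sum_congr rfl fun v _ => h1 v, this, hp, hm]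
    ring
  have hU : (∑ v, if v ∈ (T ∪ R)ᶜ then β else 0) = m * β := by
    rw [sum_ite_mem_const, hm]
  have hRr : (∑ v, if v ∈ R then r ^ 2 else 0) = p * r ^ 2 := by
    rw [sum_ite_mem_const, hp]
  have hCβ : (∑ v, if v ∈ (T ∪ R)ᶜ ∧ c v = i₀ then β else 0) = C * β := by
    simp only [← mem_filter (p := fun v => c v = i₀)]
    rw [sum_ite_mem_const, hC]
  have hWβ : (∑ v, if v ∈ (T ∪ R)ᶜ ∧ c v ∈ R.image c then β else 0) = W * β := by
    simp only [← mem_filter (p := fun v => c v ∈ R.image c)]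
    rw [sum_ite_mem_const, hW]
  have hL1 : ∀ v, (∑ u, if v ∈ (T ∪ R)ᶜ then if u ∈ R ∧ c u = c v then r * β else 0 else 0) =
      if v ∈ (T ∪ R)ᶜ ∧ c v ∈ R.image c then r * β else 0 := by
    intro v
    by_cases hv : v ∈ (T ∪ R)ᶜ
    · by_cases hvR : c v ∈ R.image c
      · obtain ⟨w, hw, hwv⟩ := mem_image.1 hvR
        simp only [if_pos hv]
        rw [if_pos ⟨hv, hvR⟩, sum_eq_single w]
        · rw [if_pos ⟨hw, hwv⟩]
        · intro u _ hu
          rw [if_neg]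
          rintro ⟨huR, huv⟩
          exact hu (hR huR hw (huv.trans hwv.symm))
        · simp
      · simp only [if_pos hv]
        rw [if_neg fun h => hvR h.2]
        refine sum_eq_zero fun u _ => if_neg ?_
        rintro ⟨huR, huv⟩
        exact hvR (mem_image.2 ⟨u, huR, huv⟩)
    · simp only [sum_const_zero, hv, false_and, if_false]
  have hL : (∑ v, if v ∈ (T ∪ R)ᶜ ∧ c v ∈ R.image c then r * β else 0) = W * (r * β) := by
    simp only [← mem_filter (p := fun v => c v ∈ R.image c)]
    rw [sum_ite_mem_const, hW]
  simp only [lowerEntry, sum_add_distrib, sum_sub_distrib, ← mul_sum, ← sum_mul, sum_ite_eq,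
    mem_univ, if_true]
  rw [sum_comm (f := fun u v => if v ∈ (T ∪ R)ᶜ then if u ∈ R ∧ c u = c v then r * β else 0 else 0)]
  simp only [hL1, hL]
  rw [hz1, hz2, hg, hU, hRr, hCβ, hWβ]
  ring

end TestVector

end SimpleGraph

/-! ### The quotient cubic and its dependence on `s` -/

namespace SimpleGraph

/-- The characteristic polynomial, in `x = μ + 1`, of the quotient of the distance matrix of
`K_N ∨ (K_m ∪ p K_1)`. -/
def quotientPoly (N m p x : ℝ) : ℝ :=
  x ^ 3 - (N + m + 2 * p - 1) * x ^ 2 - (2 * p * m + N + m - N * p) * x + N * p * m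

/-- The denominator obtained when solving for the eigenvector of the quotient matrix. -/
def quotientDet (m p x : ℝ) : ℝ := x * (x + 1 - p) - p * m

theorem quotientDet_pos {m p x : ℝ} (hm : 0 ≤ m) (hp : 0 ≤ p) (hx : p + m < x) :
    0 < quotientDet m p x := by
  unfold quotientDet
  -- This leaves the lower bound `(x - p)² + x`.
  have h1 : p * m ≤ p * (x - p) := by gcongr; linarith
  nlinarith

/-- The value at the test vector `(Δ, x (x + m), x (x + 1))` of the distance form of
`K_N ∨ (K_m ∪ p K_1)`, minus `x - 1` times the squared norm. -/
theorem distForm_testVector (N m p x : ℝ) :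
    (N * quotientDet m p x + p * (x * (x + m)) + m * (x * (x + 1))) ^ 2 -
        (N * quotientDet m p x ^ 2 + p * (x * (x + m)) ^ 2 + m * (x * (x + 1)) ^ 2) +
        (p * (x * (x + m)) + m * (x * (x + 1))) ^ 2 - (m * (x * (x + 1))) ^ 2 -
        p * (x * (x + m)) ^ 2 =
      (x - 1) * (N * quotientDet m p x ^ 2 + p * (x * (x + m)) ^ 2 + m * (x * (x + 1)) ^ 2) -
        quotientPoly N m p x * (x * quotientDet m p x - quotientPoly N m p x) := by
  -- The entries sum to `x * quotientDet - quotientPoly`, and every row of the eigenvector equation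
  -- has error `-quotientPoly`.
  unfold quotientDet quotientPoly
  ring

/-- Intermediate value theorem on the ray starting at `n + b + 1`, where `n = m + k + b + 2`. It
does not matter which root is found: a positive eigenvector will certify it as an upper bound. -/
theorem exists_quotientPoly_root {b k m : ℕ}
    (hn : b ^ 2 + 2 * b * k + 5 * b + 2 * k + 4 ≤ b * (m + k + b + 2)) :
    ∃ x : ℝ, (m + k + b + 2) + b + 1 ≤ x ∧ quotientPoly (k + 1) m (b + 1) x = 0 := by
  have hm : k + 4 ≤ m := by
    by_contra! h
    have : b * (m + k + b + 2) ≤ b * (2 * k + b + 5) := Nat.mul_le_mul_left _ (by omega)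
    nlinarith
  have hm' : (k : ℝ) + 4 ≤ m := by exact_mod_cast hm
  have hk : (0 : ℝ) ≤ k := Nat.cast_nonneg k
  have hb : (0 : ℝ) ≤ b := Nat.cast_nonneg b
  set x₀ : ℝ := (m + k + b + 2) + b + 1 with hx₀
  -- With `N = k + 1` and `p = b + 1`, the coefficient `N + m + 2p - 1` equals `x₀ - 1`; the
  -- increment added here is large enough to absorb the linear term of the cubic.
  set x₁ : ℝ := x₀ + 2 * (b + 1) * m + (m + k + b + 2) with hx₁
  have hbm : 0 ≤ (b : ℝ) * m := by positivity
  have h01 : x₀ ≤ x₁ := by rw [hx₁]; nlinarith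
  have hlow : quotientPoly (k + 1) m (b + 1) x₀ ≤ 0 := by
    have : quotientPoly (k + 1) m (b + 1) x₀ = (b + 1) * (x₀ * (2 - 2 * m + (k + 1)) +
        (k + 1) * m) := by
      rw [hx₀]; unfold quotientPoly; ring
    rw [this]
    have h1 : x₀ * (2 - 2 * m + (k + 1)) ≤ x₀ * (- m) :=
      mul_le_mul_of_nonneg_left (by linarith) (by positivity)
    have h2 : (k + 1 : ℝ) * m ≤ x₀ * m :=
      mul_le_mul_of_nonneg_right (by linarith) (by positivity)
    have h3 : x₀ * (2 - 2 * m + (k + 1)) + (k + 1) * m ≤ 0 := by linarith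
    exact mul_nonpos_of_nonneg_of_nonpos (by positivity) h3
  have hhigh : 0 ≤ quotientPoly (k + 1) m (b + 1) x₁ := by
    have : quotientPoly (k + 1) m (b + 1) x₁ =
        x₁ * ((x₁ - 1) * (2 * (b + 1) * m + (m + k + b + 2)) + x₁ + (b + 1) + (k + 1) * (b + 1))
          + (k + 1) * (b + 1) * m := by
      rw [hx₁, hx₀]; unfold quotientPoly; ring
    rw [this]
    have : 0 ≤ x₁ - 1 := by linarith
    positivity
  have hcont : ContinuousOn (quotientPoly (k + 1) m (b + 1)) (Set.Icc x₀ x₁) := by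
    unfold quotientPoly
    fun_prop
  obtain ⟨x, hx, hx0⟩ := intermediate_value_Icc h01 hcont ⟨hlow, hhigh⟩
  exact ⟨x, hx.1, hx0⟩

/-- For `b ≥ 3` this follows from `s ≥ 2` alone, since `b² ≥ 3b ≥ b + 6`. The order bound and `k ≥
1` are needed for `b = 1`, where the claim is `s + 2e ≥ 6`. -/
theorem coefficient_bound {b k s e : ℕ} (hb : Odd b) (hk : 0 < k) (hs : 2 ≤ s)
    (hn : b ^ 2 + 2 * b * k + 5 * b + 2 * k + 4 ≤ b * ((b + 1) * s + k + e + 2)) :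
    b * e + b ^ 2 + b + 4 ≤ b ^ 2 * s + 3 * b * e := by
  rcases (show b = 1 ∨ 3 ≤ b by obtain ⟨c, rfl⟩ := hb; omega) with rfl | hb3
  · omega
  · nlinarith [Nat.mul_le_mul_left (b ^ 2) hs, Nat.mul_le_mul hb3 (le_refl b),
      Nat.zero_le (b * e)]

/-- Moving from one to `s ≥ 2` dominating vertices in excess of `k` makes the quotient polynomial
negative at every large root. -/
theorem quotientPoly_neg {b k s e : ℕ} (hb : Odd b) (hk : 0 < k) (hs : 2 ≤ s)
    (hn : b ^ 2 + 2 * b * k + 5 * b + 2 * k + 4 ≤ b * ((b + 1) * s + k + e + 2)) {x : ℝ}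
    (hx : ((b + 1) * s + k + e + 2) + b + 1 ≤ x)
    (h0 : quotientPoly (k + 1) ((b + 1) * (s - 1) + e + 1) (b + 1) x = 0) :
    quotientPoly (k + s) (e + 1) (b * s + 1) x < 0 := by
  have hQ := coefficient_bound hb hk hs hn
  have hb1 : (1 : ℝ) ≤ b := by exact_mod_cast hb.pos
  have hk1 : (0 : ℝ) ≤ k := Nat.cast_nonneg k
  have he : (0 : ℝ) ≤ e := Nat.cast_nonneg e
  have hs2 : (2 : ℝ) ≤ s := by exact_mod_cast hs
  have hnR : (b : ℝ) ^ 2 + 2 * b * k + 5 * b + 2 * k + 4 ≤ b * ((b + 1) * s + k + e + 2) := by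
    exact_mod_cast hn
  have hQR : (b : ℝ) * e + b ^ 2 + b + 4 ≤ b ^ 2 * s + 3 * b * e := by exact_mod_cast hQ
  generalize (b : ℝ) = B at *
  generalize (k : ℝ) = K at *
  generalize (s : ℝ) = S at *
  generalize (e : ℝ) = E at *
  obtain ⟨y, hy, rfl⟩ : ∃ y : ℝ, 0 ≤ y ∧ x = ((B + 1) * S + K + E + 2) + B + 1 + y :=
    ⟨x - (((B + 1) * S + K + E + 2) + B + 1), by linarith, by ring⟩
  set x₀ : ℝ := ((B + 1) * S + K + E + 2) + B + 1 with hx₀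
  set A : ℝ := - B * S + 2 * B * E - B * K - 4 * B - 3 - 2 * B ^ 2 with hA
  set C : ℝ := x₀ * (B ^ 2 * S + 3 * B * E - B ^ 2 - B - 3) - E * (B * S + B + B * K + 1) +
    (B ^ 2 + B - B * S + B ^ 2 * K + B * K + K) with hC
  have hBS : 0 ≤ B * S := by positivity
  have hBK : 0 ≤ B * K := by positivity
  have hBE : 0 ≤ B * E := by positivity
  have hx₀' : B * S + S + K + E + 3 + B = x₀ := by rw [hx₀]; ring
  have hx₀0 : 0 ≤ x₀ := by rw [← hx₀']; positivity
  have hCpos : 0 < C := by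
    have h1 : x₀ * (B * E + 1) ≤ x₀ * (B ^ 2 * S + 3 * B * E - B ^ 2 - B - 3) :=
      mul_le_mul_of_nonneg_left (by linarith) hx₀0
    have h2 : E * (B * S + B + B * K + 1) ≤ E * (B * x₀) := by
      refine mul_le_mul_of_nonneg_left ?_ he
      have : B * x₀ = B * (B * S) + B * S + B * K + B * E + 3 * B + B * B := by
        rw [← hx₀']; ring
      nlinarith
    have h3 : 0 ≤ B ^ 2 * K := by positivity
    rw [hC]
    nlinarith
  have hslope : 0 ≤ 2 * B * x₀ + A := by
    have : 2 * B * x₀ + A = B * ((B + 1) * S + K + E + 2) + (B ^ 2 * S + 3 * B * E) -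
        3 := by
      rw [hA, hx₀]; ring
    nlinarith
  -- At fixed order the difference of the two cubics is divisible by `S - 1`; the quotient, expanded
  -- around `x₀ = n + b + 1`, is `C + (2Bx₀ + A)y + By²`, positive for `y ≥ 0`.
  have key : quotientPoly (K + S) (E + 1) (B * S + 1) (x₀ + y) =
      quotientPoly (K + 1) ((B + 1) * (S - 1) + E + 1) (B + 1) (x₀ + y) -
        (S - 1) * (C + y * (B * y + (2 * B * x₀ + A))) := by
    rw [hC, hA, hx₀]
    unfold quotientPoly
    ring
  rw [key, h0, zero_sub, neg_lt_zero]
  have : 0 < S - 1 := by linarith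
  have h4 : 0 ≤ y * (B * y + (2 * B * x₀ + A)) := by positivity
  exact mul_pos this (by linarith)

end SimpleGraph

/-! ### The extremal graph: spectral bound, non-criticality, recognition -/

namespace SimpleGraph

open Finset

section ExtremalGraph

variable {n k b : ℕ}

/-- The distances in the extremal graph from a vertex `u`, bounded by one plus the correction `f`
accounting for the vertices not adjacent to `u`. -/
theorem sum_dist_extremalGraph_le {z : Fin (k + 1) ⊕ (Fin (n - k - b - 2) ⊕ Fin (b + 1)) → ℝ}
    (hz : ∀ v, 0 < z v) (u : Fin (k + 1) ⊕ (Fin (n - k - b - 2) ⊕ Fin (b + 1)))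
    (f : Fin (k + 1) ⊕ (Fin (n - k - b - 2) ⊕ Fin (b + 1)) → ℝ) (hf : ∀ v, 0 ≤ f v)
    (h : ∀ v, u ≠ v → ¬ (extremalGraph n k b).Adj u v → 1 ≤ f v) :
    ∑ v, ((extremalGraph n k b).dist u v : ℝ) * z v ≤ ∑ v, z v - z u + ∑ v, f v * z v := by
  classical
  have hle : ∀ v, ((extremalGraph n k b).dist u v : ℝ) ≤ 1 - (if u = v then 1 else 0) + f v := by
    intro v
    rcases eq_or_ne u v with rfl | hne
    · simpa using hf u
    by_cases hadj : (extremalGraph n k b).Adj u v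
    · rw [dist_eq_one_iff_adj.2 hadj]
      simpa [hne] using hf v
    · have hdom : ∀ w, Sum.inl 0 ≠ w → (extremalGraph n k b).Adj (Sum.inl 0) w := by
        rintro (w | w | w) hw
        · simpa [extremalGraph, joinGraph] using hw
        · simp [extremalGraph, joinGraph]
        · simp [extremalGraph, joinGraph]
      have hu : Sum.inl 0 ≠ u := by
        rintro rfl
        exact hadj (hdom v hne)
      have hv : Sum.inl 0 ≠ v := by
        rintro rfl
        exact hadj (hdom u hne.symm).symm
      have h2 : (extremalGraph n k b).dist u v ≤ 2 :=
        dist_le (Walk.cons (hdom u hu).symm (Walk.cons (hdom v hv) Walk.nil))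
      have h2' : ((extremalGraph n k b).dist u v : ℝ) ≤ 2 := by exact_mod_cast h2
      have := h v hne hadj
      simp only [hne, if_false]
      linarith
  calc ∑ v, ((extremalGraph n k b).dist u v : ℝ) * z v
      ≤ ∑ v, (1 - (if u = v then 1 else 0) + f v) * z v :=
        sum_le_sum fun v _ => mul_le_mul_of_nonneg_right (hle v) (hz v).le
    _ = _ := by
        simp only [add_mul, sub_mul, one_mul, sum_add_distrib, sum_sub_distrib, ite_mul, zero_mul,
          sum_ite_eq, mem_univ, if_true]

/-- A large root of the quotient polynomial bounds the distance spectral radius of the extremal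
graph. -/
theorem distanceSpectralRadius_extremalGraph_le {x : ℝ}
    (hx : ((n - k - b - 2 : ℕ) : ℝ) + (b + 1) < x)
    (h0 : quotientPoly (k + 1) (n - k - b - 2 : ℕ) (b + 1) x = 0) :
    (extremalGraph n k b).distanceSpectralRadius ≤ x - 1 := by
  have hm0 : (0 : ℝ) ≤ (n - k - b - 2 : ℕ) := Nat.cast_nonneg _
  have hb0 : (0 : ℝ) ≤ b := Nat.cast_nonneg b
  have hΔ : 0 < quotientDet (n - k - b - 2 : ℕ) (b + 1) x :=
    quotientDet_pos hm0 (by positivity) (by linarith)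
  have hx0 : 0 < x := by linarith
  let z : Fin (k + 1) ⊕ (Fin (n - k - b - 2) ⊕ Fin (b + 1)) → ℝ :=
    Sum.elim (fun _ => quotientDet (n - k - b - 2 : ℕ) (b + 1) x)
      (Sum.elim (fun _ => x * (x + 1)) (fun _ => x * (x + (n - k - b - 2 : ℕ))))
  have hz : ∀ v, 0 < z v := by
    rintro (v | v | v)
    · exact hΔ
    · exact mul_pos hx0 (by linarith)
    · exact mul_pos hx0 (by linarith)
  -- This is the only eigenvector equation that needs `x` to be a root; granted it, the other rows
  -- hold identically.
  have hsum : ∑ v, z v = x * quotientDet (n - k - b - 2 : ℕ) (b + 1) x := by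
    have : ∑ v, z v = x * quotientDet (n - k - b - 2 : ℕ) (b + 1) x -
        quotientPoly (k + 1) (n - k - b - 2 : ℕ) (b + 1) x := by
      simp only [z, Fintype.sum_sum_type, Sum.elim_inl, Sum.elim_inr, sum_const, card_univ,
        Fintype.card_fin, nsmul_eq_mul]
      push_cast
      unfold quotientDet quotientPoly
      ring
    rw [this, h0, sub_zero]
  refine distanceSpectralRadius_le_of_pos _ z _ hz ?_
  rintro (u | u | u)
  · refine (sum_dist_extremalGraph_le hz (Sum.inl u) (fun _ => 0) (fun _ => le_rfl) ?_).trans ?_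
    · rintro (v | v | v) hne hadj
      · exact absurd (by simpa [extremalGraph, joinGraph] using hne) hadj
      · exact absurd (by simp [extremalGraph, joinGraph]) hadj
      · exact absurd (by simp [extremalGraph, joinGraph]) hadj
    · rw [hsum]
      simp only [z, Sum.elim_inl, zero_mul, sum_const_zero]
      linarith
  · refine (sum_dist_extremalGraph_le hz (Sum.inr (Sum.inl u))
      (Sum.elim (fun _ => 0) (Sum.elim (fun _ => 0) (fun _ => 1))) ?_ ?_).trans ?_
    · rintro (v | v | v) <;> simp
    · rintro (v | v | v) hne hadj
      · exact absurd (by simp [extremalGraph, joinGraph]) hadj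
      · exact absurd (by simpa [extremalGraph, joinGraph] using hne) hadj
      · simp
    · rw [hsum]
      simp only [z, Fintype.sum_sum_type, Sum.elim_inl, Sum.elim_inr, sum_const, card_univ,
        Fintype.card_fin, nsmul_eq_mul, zero_mul, mul_zero, zero_add, one_mul]
      push_cast
      unfold quotientDet
      apply le_of_eq
      ring
  · refine (sum_dist_extremalGraph_le hz (Sum.inr (Sum.inr u))
      (Sum.elim (fun _ => 0) (Sum.elim (fun _ => 1) (fun v => 1 - if u = v then 1 else 0)))
      ?_ ?_).trans ?_
    · rintro (v | v | v)
      · simp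
      · simp
      · by_cases h : u = v <;> simp [h]
    · rintro (v | v | v) hne hadj
      · exact absurd (by simp [extremalGraph, joinGraph]) hadj
      · simp
      · have : u ≠ v := fun h => hne (by rw [h])
        simp [this]
    · rw [hsum]
      simp only [z, Fintype.sum_sum_type, Sum.elim_inl, Sum.elim_inr, sum_const, card_univ,
        Fintype.card_fin, nsmul_eq_mul, zero_mul, mul_zero, zero_add, one_mul, sub_mul,
        sum_sub_distrib, ite_mul, sum_ite_eq, mem_univ, if_true]
      push_cast
      unfold quotientDet
      apply le_of_eq
      ring

/-- A graph isomorphic to the extremal graph is not critical: deleting `k` of the dominating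
vertices leaves `b + 1` vertices whose only neighbour is the remaining one. -/
theorem not_isCriticalForOddFactor_of_iso {V : Type*} (G : SimpleGraph V)
    (φ : G ≃g extremalGraph n k b) : ¬ G.IsCriticalForOddFactor k b := by
  classical
  intro hcrit
  let X : Finset V := univ.image fun i : Fin k => φ.symm (Sum.inl i.castSucc)
  have hX : X.card = k := by
    rw [card_image_of_injective, card_univ, Fintype.card_fin]
    intro i j hij
    exact Fin.castSucc_injective _ (Sum.inl_injective (φ.symm.injective hij))
  obtain ⟨F, hF, hdeg⟩ := hcrit X hX
  have hmemX : ∀ v, v ∈ X ↔ ∃ i : Fin k, Sum.inl i.castSucc = φ v := by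
    intro v
    simp only [X, mem_image, mem_univ, true_and]
    exact exists_congr fun i => by
      rw [← φ.injective.eq_iff, φ.apply_symm_apply]
  let w : {v : V | v ∉ X} := ⟨φ.symm (Sum.inl (Fin.last k)), by
    rw [Set.mem_ofPred_eq, hmemX]
    rintro ⟨i, hi⟩
    rw [φ.apply_symm_apply] at hi
    exact (Fin.castSucc_lt_last i).ne (Sum.inl_injective hi)⟩
  let y : Fin (b + 1) → {v : V | v ∉ X} := fun j => ⟨φ.symm (Sum.inr (Sum.inr j)), by
    rw [Set.mem_ofPred_eq, hmemX]
    rintro ⟨i, hi⟩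
    rw [φ.apply_symm_apply] at hi
    simp at hi⟩
  have hy : Function.Injective y := by
    intro i j hij
    have := φ.symm.injective (congrArg Subtype.val hij)
    simpa using this
  have hadj : ∀ j, F.Adj w (y j) := by
    intro j
    have hne : (F.neighborSet (y j)).Nonempty := by
      apply Set.nonempty_of_ncard_ne_zero
      have := (hdeg (y j)).2.1
      omega
    obtain ⟨v, hv⟩ := hne
    have hG : G.Adj (y j).1 v.1 := hF hv
    rw [← φ.map_adj_iff] at hG
    have hyj : φ (y j).1 = Sum.inr (Sum.inr j) := φ.apply_symm_apply _
    rw [hyj] at hG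
    have hvw : v = w := by
      have hvX := v.2
      rw [Set.mem_ofPred_eq, hmemX] at hvX
      apply Subtype.ext
      rw [← φ.injective.eq_iff]
      change φ v.1 = φ (φ.symm (Sum.inl (Fin.last k)))
      rw [φ.apply_symm_apply]
      rcases hφ : φ v.1 with i | i | i
      · induction i using Fin.lastCases with
        | last => rfl
        | cast i => exact absurd ⟨i, hφ.symm⟩ hvX
      · rw [hφ] at hG
        simp [extremalGraph, joinGraph] at hG
      · rw [hφ] at hG
        simp [extremalGraph, joinGraph] at hG
    rw [← hvw]
    exact Adj.symm hv
  have hcard : b + 1 ≤ (F.neighborSet w).ncard := by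
    have hfin : (F.neighborSet w).Finite := by
      apply Set.finite_of_ncard_ne_zero
      have := (hdeg w).2.1
      omega
    have h1 : (Set.range y).ncard = b + 1 := by
      rw [← Set.image_univ, Set.ncard_image_of_injective _ hy, Set.ncard_univ,
        Nat.card_eq_fintype_card, Fintype.card_fin]
    rw [← h1]
    refine Set.ncard_le_ncard ?_ hfin
    rintro _ ⟨j, rfl⟩
    exact hadj j
  have := (hdeg w).2.2
  omega

/-- A graph with `k + 1` dominating vertices and `b + 1` further vertices adjacent only to these,
the rest forming a clique, is the extremal graph. -/
theorem nonempty_iso_extremalGraph {V : Type*} [Fintype V] [DecidableEq V] (G : SimpleGraph V)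
    {T R : Finset V} (hTR : Disjoint T R) (hT : #T = k + 1) (hR : #R = b + 1)
    (hU : #(T ∪ R)ᶜ = n - k - b - 2)
    (hadj : ∀ u v, u ≠ v → (G.Adj u v ↔ u ∈ T ∨ v ∈ T ∨ (u ∉ R ∧ v ∉ R))) :
    Nonempty (G ≃g extremalGraph n k b) := by
  let f : Fin (k + 1) ⊕ (Fin (n - k - b - 2) ⊕ Fin (b + 1)) → V :=
    Sum.elim (fun i => (T.equivFinOfCardEq hT).symm i)
      (Sum.elim (fun i => ((T ∪ R)ᶜ.equivFinOfCardEq hU).symm i)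
        (fun i => (R.equivFinOfCardEq hR).symm i))
  have hfT : ∀ i, f (Sum.inl i) ∈ T := fun i => ((T.equivFinOfCardEq hT).symm i).2
  have hfU : ∀ i, f (Sum.inr (Sum.inl i)) ∈ (T ∪ R)ᶜ :=
    fun i => (((T ∪ R)ᶜ.equivFinOfCardEq hU).symm i).2
  have hfR : ∀ i, f (Sum.inr (Sum.inr i)) ∈ R := fun i => ((R.equivFinOfCardEq hR).symm i).2
  simp only [mem_compl, mem_union, not_or] at hfU
  have hfRT : ∀ i, f (Sum.inr (Sum.inr i)) ∉ T := fun i => disjoint_right.1 hTR (hfR i)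
  have hinj : Function.Injective f := by
    rintro (i | i | i) (j | j | j) h
    · exact congrArg _ ((T.equivFinOfCardEq hT).symm.injective (Subtype.ext h))
    · exact absurd (h ▸ hfT i) (hfU j).1
    · exact absurd (h ▸ hfT i) (hfRT j)
    · exact absurd (h ▸ hfT j) (hfU i).1
    · exact congrArg _ (congrArg _
        (((T ∪ R)ᶜ.equivFinOfCardEq hU).symm.injective (Subtype.ext h)))
    · exact absurd (h ▸ hfR j) (hfU i).2
    · exact absurd (h ▸ hfT j) (hfRT i)
    · exact absurd (h ▸ hfR i) (hfU j).2
    · exact congrArg _ (congrArg _ ((R.equivFinOfCardEq hR).symm.injective (Subtype.ext h)))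
  have hbij : Function.Bijective f := by
    rw [Fintype.bijective_iff_injective_and_card]
    refine ⟨hinj, ?_⟩
    have := card_add_card_compl (T ∪ R)
    rw [card_union_of_disjoint hTR] at this
    simp only [Fintype.card_sum, Fintype.card_fin]
    omega
  refine ⟨(RelIso.mk (Equiv.ofBijective f hbij) ?_ : extremalGraph n k b ≃g G).symm⟩
  intro x y
  simp only [Equiv.ofBijective_apply]
  rcases eq_or_ne x y with rfl | hne
  · simp
  rw [hadj _ _ (hinj.ne hne)]
  rcases x with i | i | i <;> rcases y with j | j | j <;>
    simp [hfT, hfU, hfR, hfRT, extremalGraph, joinGraph] <;>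
    exact fun h => hne (by rw [h])

end ExtremalGraph

/-! ### Rigidity in the Rayleigh bound -/

theorem IsVertexConnected.connected {V : Type*} [Fintype V] {G : SimpleGraph V} {m : ℕ}
    (h : G.IsVertexConnected (m + 1)) : G.Connected := by
  have hS := h.2 ∅ (by simp)
  have : Nonempty V := ⟨hS.nonempty.some.1⟩
  refine ⟨fun u v => ?_⟩
  exact (hS.preconnected ⟨u, by simp⟩ ⟨v, by simp⟩).map (Embedding.induce _).toHom

/-- Rigidity: if the quotient polynomial of `K_N ∨ (K_m ∪ p K_1)` is non-positive at `x` and the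
distance spectral radius of `G` is at most `x - 1`, then `G` is exactly `K_N ∨ (K_m ∪ p K_1)` and
`x` is a root. -/
theorem eq_of_distanceSpectralRadius_le {V ι : Type*} [Fintype V] [DecidableEq V] [DecidableEq ι]
    {G : SimpleGraph V} (hG : G.Connected) {T R : Finset V} (hTR : Disjoint T R) {c : V → ι}
    (hc : ∀ u v, u ∉ T → v ∉ T → c u ≠ c v → ¬ G.Adj u v) (hR : Set.InjOn c R) {i₀ : ι}
    (hi₀ : i₀ ∉ R.image c)
    (hC : 2 ≤ #((T ∪ R)ᶜ.filter fun v => c v = i₀) ∨ ∀ v ∈ (T ∪ R)ᶜ, c v ∉ R.image c)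
    {N p m x : ℝ} (hN : (#T : ℝ) = N) (hp : (#R : ℝ) = p) (hm : (#(T ∪ R)ᶜ : ℝ) = m)
    (hx : p + m < x) (hf : quotientPoly N m p x ≤ 0) (hμ : G.distanceSpectralRadius ≤ x - 1) :
    quotientPoly N m p x = 0 ∧
      ∀ u v, u ≠ v → (G.Adj u v ↔ u ∈ T ∨ v ∈ T ∨ (u ∉ R ∧ v ∉ R)) := by
  have : Nonempty V := hG.nonempty
  have hp0 : 0 ≤ p := hp ▸ Nat.cast_nonneg _
  have hm0 : 0 ≤ m := hm ▸ Nat.cast_nonneg _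
  have hxpos : 0 < x := by linarith
  obtain ⟨W, hW⟩ : ∃ W : ℝ, (#((T ∪ R)ᶜ.filter fun v => c v ∈ R.image c) : ℝ) = W := ⟨_, rfl⟩
  obtain ⟨D, hD⟩ : ∃ D : ℝ, (#((T ∪ R)ᶜ.filter fun v => c v = i₀) : ℝ) = D := ⟨_, rfl⟩
  have hΔ : 0 < quotientDet m p x := quotientDet_pos hm0 hp0 hx
  have hβ : 0 < x * (x + 1) := by positivity
  have hr : 0 < x * (x + m) := by positivity
  -- So two vertices of colour `i₀` already outweigh the loss of one `rβ`.
  have hr2 : x * (x + m) < 2 * (x * (x + 1)) := by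
    nlinarith [mul_pos hxpos (show 0 < x + 2 - m by linarith)]
  have hform := distForm_testVector N m p x
  have hlower := sum_sum_lowerEntry hTR hR i₀ (quotientDet m p x) (x * (x + 1)) (x * (x + m))
    hN hp hm hD hW
  rw [hform] at hlower
  have hsq := sum_threeValued_apply hTR (quotientDet m p x) (x * (x + 1)) (x * (x + m))
    (fun y => y ^ 2)
  rw [hN, hp, hm] at hsq
  rw [← hsq] at hlower
  generalize quotientDet m p x = Δ at *
  generalize quotientPoly N m p x = f at *
  generalize x * (x + 1) = β at *
  generalize x * (x + m) = r at *
  -- The correction is non-negative, and vanishes only if no vertex outside `T ∪ R` shares a colour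
  -- with `R`.
  have hWD : 0 ≤ W * (β * (D * β - r)) ∧
      (W * (β * (D * β - r)) ≤ 0 → ∀ v ∈ (T ∪ R)ᶜ, c v ∉ R.image c) := by
    rcases hC with h2 | h0
    · have hD2 : 2 ≤ D := by rw [← hD]; exact_mod_cast h2
      have hpos : 0 < β * (D * β - r) := mul_pos hβ (by nlinarith)
      refine ⟨mul_nonneg (hW ▸ Nat.cast_nonneg _) hpos.le, fun hle v hv hvR => ?_⟩
      have hW1 : 0 < W := by
        rw [← hW]
        exact_mod_cast card_pos.2 ⟨v, mem_filter.2 ⟨hv, hvR⟩⟩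
      exact absurd (mul_pos hW1 hpos) (not_lt.2 hle)
    · have hW0 : W = 0 := by
        rw [← hW, card_eq_zero.2 (filter_eq_empty_iff.2 fun v hv => h0 v hv), Nat.cast_zero]
      exact ⟨by rw [hW0, zero_mul], fun _ => h0⟩
  have hupper := (G.sum_dist_mul_le (threeValued T R Δ β r)).trans
    (mul_le_mul_of_nonneg_right hμ (sum_nonneg fun v _ => sq_nonneg _))
  have hle := lowerEntry_le hG hTR hc hR hi₀ hΔ hβ hr
  have hle' := sum_le_sum fun u (_ : u ∈ univ) => sum_le_sum fun v (_ : v ∈ univ) => hle u v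
  have hxΔ := mul_pos hxpos hΔ
  have hff : 0 ≤ -f * (x * Δ - f) := mul_nonneg (by linarith) (by linarith)
  have hf0 : f = 0 := by
    by_contra hne
    have hlt : f < 0 := lt_of_le_of_ne hf hne
    have : 0 < -f * (x * Δ - f) := mul_pos (by linarith) (by linarith)
    linarith [hWD.1]
  have hW0 := hWD.2 (by linarith)
  refine ⟨hf0, fun u v hne => ⟨fun hadj => ?_, fun huv => ?_⟩⟩
  · by_contra! h
    obtain ⟨huT, hvT, huv⟩ := h
    refine hc u v huT hvT ?_ hadj
    by_cases huR : u ∈ R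
    · by_cases hvR : v ∈ R
      · exact fun h => hne (hR huR hvR h)
      · exact fun h => hW0 v (by simp [hvT, hvR]) (mem_image.2 ⟨u, huR, h⟩)
    · exact fun h => hW0 u (by simp [huT, huR]) (mem_image.2 ⟨v, huv huR, h.symm⟩)
  -- A missing edge makes one entry bound strict, so the summed lower bound would exceed the
  -- Rayleigh upper bound.
  · by_contra hadj
    have hlt := sum_lt_sum
      (fun u (_ : u ∈ univ) => sum_le_sum fun v (_ : v ∈ univ) => hle u v) ⟨u, mem_univ u,
        sum_lt_sum (fun v (_ : v ∈ univ) => hle u v) ⟨v, mem_univ v,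
          lowerEntry_lt hG hTR i₀ hW0 hΔ hβ hr hne hadj huv⟩⟩
    linarith [hWD.1]

end SimpleGraph

/-! ### Main theorem -/

open SimpleGraph Finset in
theorem theorem1p1 (b k n : ℕ) (hb : Odd b) (hk : 0 < k) (hnk : n ≡ k [MOD 2])
    (hn : ((b : ℝ) ^ 2 + 2 * b * k + 5 * b + 2 * k + 4) / b ≤ (n : ℝ))
    {V : Type*} [Fintype V] (G : SimpleGraph V) (hV : Fintype.card V = n)
    (hconn : G.IsVertexConnected (k + 1))
    (hμ : G.distanceSpectralRadius ≤ (SimpleGraph.extremalGraph n k b).distanceSpectralRadius) :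
    (¬ Nonempty (G ≃g SimpleGraph.extremalGraph n k b) → G.IsCriticalForOddFactor k b) ∧
      (Nonempty (G ≃g SimpleGraph.extremalGraph n k b) → ¬ G.IsCriticalForOddFactor k b) := by
  classical
  refine ⟨fun hiso => ?_, fun ⟨φ⟩ => G.not_isCriticalForOddFactor_of_iso φ⟩
  by_contra hcrit
  have hG := hconn.connected
  have : Nonempty V := hG.nonempty
  have hbpos : 0 < b := hb.pos
  have hnN : b ^ 2 + 2 * b * k + 5 * b + 2 * k + 4 ≤ b * n := by
    rw [div_le_iff₀ (by exact_mod_cast hbpos)] at hn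
    rw [mul_comm b n]
    exact_mod_cast hn
  -- Ensures that the truncated subtraction `n - k - b - 2` is the true difference.
  have hnbk : k + b + 2 ≤ n := by
    by_contra! h
    have : b * n ≤ b * (k + b + 2) := Nat.mul_le_mul_left _ h.le
    nlinarith [Nat.zero_le (b * k)]
  obtain ⟨m, hm⟩ : ∃ m, m = n - k - b - 2 := ⟨_, rfl⟩
  have hnm : n = m + k + b + 2 := by omega
  obtain ⟨x, hx, hx0⟩ := exists_quotientPoly_root (b := b) (k := k) (m := m) (hnm ▸ hnN)
  have hb0 : (0 : ℝ) ≤ b := Nat.cast_nonneg b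
  have hk0 : (0 : ℝ) ≤ k := Nat.cast_nonneg k
  have hm0 : (0 : ℝ) ≤ m := Nat.cast_nonneg m
  have hρ : G.distanceSpectralRadius ≤ x - 1 := by
    refine hμ.trans (distanceSpectralRadius_extremalGraph_le ?_ ?_)
    · rw [← hm]; linarith
    · rwa [← hm]
  obtain ⟨s, T, ι, c, C, hs, hT, hc, hC, hCex⟩ :=
    G.exists_coloring_of_not_isCriticalForOddFactor hb (hV ▸ hnk) hconn hcrit
  -- Only `b s + 1` of the at least `b s + 2` parts are represented; the spare one provides `i₀` and
  -- keeps the complement of `T ∪ R` non-empty.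
  obtain ⟨R, i₀, hTR, hR, hRinj, hi₀, hC1, hC2⟩ :=
    exists_representatives T c C (b * s + 1) hC hCex
  obtain ⟨e, he⟩ : ∃ e, #(T ∪ R)ᶜ = e + 1 := by
    have := (hC1.mono (filter_subset _ _)).card_pos
    exact ⟨#(T ∪ R)ᶜ - 1, by omega⟩
  have hcard : (k + s) + (b * s + 1) + (e + 1) = n := by
    have := card_add_card_compl (T ∪ R)
    rw [card_union_of_disjoint hTR, hT, hR, he, hV] at this
    exact this
  have hcardR : (k : ℝ) + s + (b * s + 1) + (e + 1) = m + k + b + 2 := by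
    rw [hnm] at hcard
    exact_mod_cast hcard
  have hs1 : (1 : ℝ) ≤ s := by exact_mod_cast hs
  have he0 : (0 : ℝ) ≤ e := Nat.cast_nonneg e
  have hbs0 : (0 : ℝ) ≤ b * s := by positivity
  have hf : quotientPoly (k + s) (e + 1) (b * s + 1) x ≤ 0 ∧
      (s ≠ 1 → quotientPoly (k + s) (e + 1) (b * s + 1) x < 0) := by
    rcases eq_or_ne s 1 with rfl | hs'
    · refine ⟨le_of_eq ?_, fun h => absurd rfl h⟩
      rw [← hx0]
      have : (m : ℝ) = e + 1 := by push_cast at hcardR; linarith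
      rw [this, Nat.cast_one, mul_one]
    · have : quotientPoly (k + s) (e + 1) (b * s + 1) x < 0 := by
        refine quotientPoly_neg hb hk (by omega) ?_ ?_ ?_
        · have : (b + 1) * s + k + e + 2 = n := by rw [← hcard]; ring
          rwa [this]
        · linarith
        · have : ((b : ℝ) + 1) * (s - 1) + e + 1 = m := by linarith
          rwa [this]
      exact ⟨this.le, fun _ => this⟩
  obtain ⟨hf0, hadj⟩ := eq_of_distanceSpectralRadius_le hG hTR hc hRinj hi₀ hC2
    (N := k + s) (p := b * s + 1) (m := e + 1) (by rw [hT]; push_cast; rfl)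
    (by rw [hR]; push_cast; rfl) (by rw [he]; push_cast; rfl) (by linarith) hf.1 hρ
  have hs_eq : s = 1 := by
    by_contra hs'
    exact (hf.2 hs').ne hf0
  subst hs_eq
  exact hiso (G.nonempty_iso_extremalGraph hTR hT (by omega) (by omega) hadj)
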